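/- Let $d\ge 1$, let $\mathbb{T}^d=\mathbb{R}^d/\mathbb{Z}^d$ with its Euclidean metric and Lebesgue measure $\lambda$, and let $B(x,r)$ denote the open ball with centre $x$ and radius $r$ in $\mathbb{T}^d$. Write $\limsup_{j\to\infty}A_j=\bigcap_{k}\bigcup_{j\ge k}A_j$. A dyadic cube of $\mathbb{T}^d$ is the image $D$ in $\mathbb{T}^d$ of a cube $\prod_{i=1}^d[k_i2^{-n},(k_i+1)2^{-n})$ with integers $n\ge 0$ and $k_1,\dots,k_d$; put $|D|=\sqrt d\,2^{-n}$ (the diameter of that cube in $\mathbb{R}^d$). For $t\ge 0$ and $E\subset\mathbb{T}^d$ let \[ \mathscr{M}^t_\infty(E)=\inf\Bigl\{\sum_k|D_k|^t : E\subset\bigcup_kD_k,\ D_k\text{ dyadic cubes}\Bigr\}, \] the infimum being over countable (possibly finite or empty) families. For $s\ge 0$ let $\mathscr{G}^s(\mathbb{T}^d)$ be the class of all $G_\delta$-sets $E\subset\mathbb{T}^d$ such that $\mathscr{M}^t_\infty(E\cap D)\ge|D|^t$ for all dyadic cubes $D$ and all $0\le t<s$. Let $(x_j)_{j\ge1}$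 be a sequence of points of $\mathbb{T}^d$ and let $(r_j)_{j\ge1}$ be a sequence of positive radii such that $E=\limsup_{j\to\infty}B(x_j,r_j)$ has full Lebesgue measure, that is $\lambda(\mathbb{T}^d\setminus E)=0$. Let $0\le s\le d$ and \[ E_U=\limsup_{j\to\infty}B\bigl(x_j,r_j^{d/s}\bigr), \] where $r_j^{d/s}$ is read as $0$ (so that the balls are empty) if $s=0$. Then the Hausdorff dimension of $E_U$ is at least $s$ (with the convention $\dim_{\mathrm H}\emptyset=0$). If moreover $r_j\to0$ as $j\to\infty$, then $E_U\in\mathscr{G}^s(\mathbb{T}^d)$. -/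

import Mathlib

open Set Filter Topology MeasureTheory
open scoped NNReal ENNReal

/-- The torus `𝕋^d = ℝ^d / ℤ^d` with its Euclidean (quotient) metric
`|x - y| = (∑ i, ‖x i - y i‖ ^ 2) ^ (1 / 2)`, where `‖·‖` on `ℝ / ℤ` is the distance to `0`. -/
abbrev Torus (d : ℕ) : Type :=
  PiLp 2 (fun _ : Fin d => UnitAddCircle)

namespace Torus

/-- The projection `π : ℝ^d → 𝕋^d`, `π y = y mod 1`. -/
def proj {d : ℕ} (y : Fin d → ℝ) : Torus d :=
  WithLp.toLp 2 (fun i => (y i : UnitAddCircle))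

/-- Lebesgue measure `λ` on `𝕋^d`: the product of the Haar probability measures of the `d`
circles. -/
noncomputable def lebesgue (d : ℕ) : Measure (Torus d) :=
  (volume : Measure (Fin d → UnitAddCircle)).map (WithLp.toLp 2)

/-- The dyadic cube `∏ i, [k i * 2 ^ (-n), (k i + 1) * 2 ^ (-n))` of side length `2 ^ (-n) ≤ 1`,
viewed in the torus. -/
def dyadicCube {d : ℕ} (n : ℕ) (k : Fin d → ℤ) : Set (Torus d) :=
  proj '' Set.univ.pi fun i => Ico ((k i : ℝ) / 2 ^ n) (((k i : ℝ) + 1) / 2 ^ n)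

/-- The (Euclidean) diameter `|D| = √d * 2 ^ (-n)` of a dyadic cube of side length `2 ^ (-n)`
in dimension `d`. -/
noncomputable def cubeDiam (d n : ℕ) : ℝ≥0∞ :=
  ENNReal.ofReal (√(d : ℝ) / 2 ^ n)

/-- The outer content `ℳ_∞^t (E)`: the infimum of `∑ |D_k| ^ t` over all families of dyadic cubes
`D_k` that cover `E`. The families are sets of indices `(n, k)`, hence countable. -/
noncomputable def dyadicContent {d : ℕ} (t : ℝ) (E : Set (Torus d)) : ℝ≥0∞ :=
  ⨅ (C : Set (ℕ × (Fin d → ℤ))) (_ : E ⊆ ⋃ c ∈ C, dyadicCube c.1 c.2),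
    ∑' c : C, cubeDiam d c.1.1 ^ t

/-- The class `𝒢^s (𝕋^d)` of sets with large intersections: the `G_δ` sets `E` such that
`ℳ_∞^t (E ∩ D) ≥ |D| ^ t` for all dyadic cubes `D` and all `0 ≤ t < s`. -/
def LargeIntersection (d : ℕ) (s : ℝ) : Set (Set (Torus d)) :=
  {E | IsGδ E ∧ ∀ t : ℝ, 0 ≤ t → t < s → ∀ (n : ℕ) (k : Fin d → ℤ),
    cubeDiam d n ^ t ≤ dyadicContent t (E ∩ dyadicCube n k)}

/-- The shrunken radius `r ^ (d / s)`, read as `r ^ ∞ = 0` if `s = 0`. -/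
noncomputable def shrunkRadius (d : ℕ) (s r : ℝ) : ℝ :=
  if s = 0 then 0 else r ^ ((d : ℝ) / s)

end Torus

/-! Let `0 ≤ t < s` and `r j → 0`. Given a family `C` of dyadic cubes, call a cube `D` cheap if the
members of `C` that meet `D` cost less than `|D| ^ t` in total. Such members are smaller than `D`
(`lt_of_mem_touching`). The heart is `exists_cube_in_ball_weight_lt`: a cheap cube contains a
smaller cheap cube inside a shrunken ball of arbitrarily large index. If `C` covered `E_U ∩ D` for
less than `|D| ^ t`, iteration would give nested cheap cubes shrinking to a point of `E_U ∩ D`. The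
member of `C` containing that point would meet every cube of the chain, hence be smaller than all of
them, which is absurd. For the heart, averaging over children gives a descendant whose relative cost
is below any prescribed `δ`, because `t < d`. If all small cubes around the centres were expensive,
a Vitali argument at the scale of the original radii (`lebesgue_iUnion_ball_mul_le`) would bound the
volume of the original balls by a multiple of the cost of the descendant. These balls cover almost
all of a fixed portion of it: a contradiction. The exponent `d / s` enters through `(r ^ (d / s)) ^
s = r ^ d`. Positive content forces positive Hausdorff measure. If the radii do not tend to zero,
`E_U` contains a ball when `s > 0`. -/

namespace Torus

variable {d : ℕ}

/-! ### Dyadic addresses and nested cubes. -/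

/-- The index in `{0, …, 2 ^ n - 1}` of the dyadic interval of level `n` of the circle that
contains `a`. -/
noncomputable def circleAddr (n : ℕ) (a : UnitAddCircle) : ℤ :=
  ⌊(2 : ℝ) ^ n * (AddCircle.equivIco 1 0 a : ℝ)⌋

/-- The index of the dyadic cube of level `n` that contains `z`. -/
noncomputable def addr (n : ℕ) (z : Torus d) : Fin d → ℤ := fun i => circleAddr n (z i)

/-- Any real lift will do: removing the integer part of `y` shifts the floor by a multiple of `2 ^
n`. -/
theorem circleAddr_coe (n : ℕ) (y : ℝ) :
    circleAddr n (y : UnitAddCircle) = ⌊(2 : ℝ) ^ n * y⌋ % 2 ^ n := by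
  have h1 : (AddCircle.equivIco 1 0 (y : UnitAddCircle) : ℝ) = Int.fract y := by
    simpa only [div_one, mul_one] using AddCircle.coe_equivIco_mk_apply (1 : ℝ) y
  have h2 : ⌊(2 : ℝ) ^ n * y⌋ / 2 ^ n = ⌊y⌋ := by
    have := Int.natCast_mul_floor_div_cancel (n := 2 ^ n) (by positivity) y
    push_cast at this
    exact this
  rw [circleAddr, h1, Int.emod_def, h2, Int.fract, mul_sub]
  have h3 : (2 : ℝ) ^ n * (⌊y⌋ : ℝ) = ((2 ^ n * ⌊y⌋ : ℤ) : ℝ) := by push_cast; rfl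
  rw [h3, Int.floor_sub_intCast]

theorem circleAddr_eq_div {n m : ℕ} (h : n ≤ m) (a : UnitAddCircle) :
    circleAddr n a = circleAddr m a / 2 ^ (m - n) := by
  have := Int.natCast_mul_floor_div_cancel (n := 2 ^ (m - n)) (by positivity)
    ((2 : ℝ) ^ n * (AddCircle.equivIco 1 0 a : ℝ))
  push_cast at this
  rw [circleAddr, circleAddr, ← this, ← mul_assoc, ← pow_add, Nat.sub_add_cancel h]

theorem circleAddr_emod (n : ℕ) (a : UnitAddCircle) :
    circleAddr n a % 2 ^ n = circleAddr n a := by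
  induction a using QuotientAddGroup.induction_on with
  | H y => rw [circleAddr_coe, Int.emod_emod]

theorem addr_eq_of_le {n m : ℕ} (h : n ≤ m) {y z : Torus d} (hyz : addr m y = addr m z) :
    addr n y = addr n z := by
  funext i
  simpa [addr, circleAddr_eq_div h] using congrArg (· / 2 ^ (m - n)) (congrFun hyz i)

/-- An index matters only modulo `2 ^ n`, since cubes live on the torus. This turns nesting,
disjointness and measurability into integer arithmetic. -/
theorem mem_dyadicCube {n : ℕ} {k : Fin d → ℤ} {z : Torus d} :
    z ∈ dyadicCube n k ↔ ∀ i, addr n z i = k i % 2 ^ n := by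
  have hp : (0 : ℝ) < 2 ^ n := by positivity
  constructor
  · rintro ⟨y, hy, rfl⟩ i
    have hi := hy i (mem_univ i)
    rw [mem_Ico, div_le_iff₀ hp, lt_div_iff₀ hp] at hi
    have : ⌊(2 : ℝ) ^ n * y i⌋ = k i := by
      rw [Int.floor_eq_iff, mul_comm]
      exact hi
    rw [addr, proj, PiLp.toLp_apply, circleAddr_coe, this]
  · intro h
    have key : ∀ i, ∃ w : ℝ, (w : UnitAddCircle) = z i ∧
        w ∈ Ico ((k i : ℝ) / 2 ^ n) (((k i : ℝ) + 1) / 2 ^ n) := by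
      intro i
      obtain ⟨y, hy⟩ := QuotientAddGroup.mk_surjective (z i)
      change (y : UnitAddCircle) = z i at hy
      have hi := h i
      rw [addr, ← hy, circleAddr_coe] at hi
      obtain ⟨c, hc⟩ := (Int.modEq_iff_dvd.1 hi)
      refine ⟨y + c, ?_, ?_⟩
      · rw [← hy]
        simp
      · have hf := Int.floor_le ((2 : ℝ) ^ n * y)
        have hf' := Int.lt_floor_add_one ((2 : ℝ) ^ n * y)
        have hk : (k i : ℝ) = ⌊(2 : ℝ) ^ n * y⌋ + 2 ^ n * c := by
          have : k i = ⌊(2 : ℝ) ^ n * y⌋ + 2 ^ n * c := by linarith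
          exact_mod_cast congrArg (Int.cast (R := ℝ)) this
        rw [mem_Ico, div_le_iff₀ hp, lt_div_iff₀ hp, hk]
        constructor <;> nlinarith
    choose w hw1 hw2 using key
    refine ⟨w, fun i _ => hw2 i, ?_⟩
    ext i
    exact hw1 i

theorem mem_dyadicCube_addr {n : ℕ} {y z : Torus d} :
    z ∈ dyadicCube n (addr n y) ↔ addr n z = addr n y := by
  simp_rw [mem_dyadicCube, funext_iff]
  exact forall_congr' fun i => by rw [show addr n y i % 2 ^ n = addr n y i from circleAddr_emod _ _]

theorem self_mem_dyadicCube_addr (n : ℕ) (y : Torus d) : y ∈ dyadicCube n (addr n y) :=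
  mem_dyadicCube_addr.2 rfl

theorem dyadicCube_addr_eq {n : ℕ} {k : Fin d → ℤ} {y : Torus d} (h : y ∈ dyadicCube n k) :
    dyadicCube n (addr n y) = dyadicCube n k := by
  ext z
  rw [mem_dyadicCube_addr, mem_dyadicCube, funext_iff]
  rw [mem_dyadicCube] at h
  exact forall_congr' fun i => by rw [h i]

theorem dyadicCube_nonempty (n : ℕ) (k : Fin d → ℤ) : (dyadicCube n k).Nonempty := by
  refine ⟨proj fun i => (k i : ℝ) / 2 ^ n, _, fun i _ => ?_, rfl⟩
  exact ⟨le_rfl, by gcongr; linarith⟩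

/-- Dyadic cubes are nested. -/
theorem dyadicCube_subset_of_mem {n m : ℕ} (h : n ≤ m) {k l : Fin d → ℤ} {y : Torus d}
    (hk : y ∈ dyadicCube n k) (hl : y ∈ dyadicCube m l) : dyadicCube m l ⊆ dyadicCube n k := by
  rw [← dyadicCube_addr_eq hk, ← dyadicCube_addr_eq hl]
  intro z hz
  rw [mem_dyadicCube_addr] at hz ⊢
  exact addr_eq_of_le h hz

/-! ### Lebesgue measure of cubes and balls. -/

theorem measurable_circleAddr (n : ℕ) : Measurable (circleAddr n) := by
  have h := (AddCircle.measurableEquivIco (1 : ℝ) 0).measurable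
  have h' : Measurable fun a : UnitAddCircle => (AddCircle.equivIco 1 0 a : ℝ) :=
    measurable_subtype_coe.comp h
  exact Int.measurable_floor.comp (h'.const_mul _)

theorem lebesgue_apply (A : Set (Torus d)) :
    lebesgue d A = (volume : Measure (Fin d → UnitAddCircle)) (WithLp.toLp 2 ⁻¹' A) :=
  (MeasurableEquiv.toLp 2 (Fin d → UnitAddCircle)).map_apply A

theorem measurableSet_dyadicCube (n : ℕ) (k : Fin d → ℤ) : MeasurableSet (dyadicCube n k) := by
  have : dyadicCube n k = ⋂ i, {z : Torus d | circleAddr n (z i) = k i % 2 ^ n} := by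
    ext z
    simp [mem_dyadicCube, addr]
  rw [this]
  refine MeasurableSet.iInter fun i => ?_
  have h : Measurable fun z : Torus d => z i := by fun_prop
  exact ((measurable_circleAddr n).comp h) (measurableSet_singleton (k i % 2 ^ n))

theorem volume_circleAddr_eq (n : ℕ) (k : ℤ) :
    volume {a : UnitAddCircle | circleAddr n a = k % 2 ^ n} = 2⁻¹ ^ n := by
  have hp : (0 : ℝ) < 2 ^ n := by positivity
  set c : ℤ := k % 2 ^ n with hc
  have hc0 : 0 ≤ c := Int.emod_nonneg _ (by positivity)
  have hc1 : c < 2 ^ n := Int.emod_lt_of_pos _ (by positivity)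
  have hc0' : (0 : ℝ) ≤ c := by exact_mod_cast hc0
  have hc1' : (c : ℝ) + 1 ≤ 2 ^ n := by exact_mod_cast hc1
  have hm : MeasurableSet {a : UnitAddCircle | circleAddr n a = c} :=
    measurable_circleAddr n (measurableSet_singleton c)
  rw [← (UnitAddCircle.measurePreserving_mk 0).measure_preimage hm.nullMeasurableSet,
    ← restrict_Ico_eq_restrict_Ioc, Measure.restrict_apply]
  · have : ((fun x : ℝ => (x : UnitAddCircle)) ⁻¹' {a | circleAddr n a = c}) ∩ Ico 0 (0 + 1) =
        Ico ((c : ℝ) / 2 ^ n) ((c + 1) / 2 ^ n) := by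
      ext x
      simp only [mem_inter_iff, mem_preimage, mem_ofPred_eq, mem_Ico, zero_add]
      rw [circleAddr_coe, div_le_iff₀ hp, lt_div_iff₀ hp]
      constructor
      · rintro ⟨h, h0, h1⟩
        rw [Int.emod_eq_of_lt (Int.floor_nonneg.2 (by positivity))
          (Int.floor_lt.2 (by push_cast; nlinarith)), Int.floor_eq_iff] at h
        rwa [mul_comm]
      · rintro ⟨h0, h1⟩
        have : ⌊(2 : ℝ) ^ n * x⌋ = c := by
          rw [Int.floor_eq_iff, mul_comm]
          exact ⟨h0, h1⟩
        rw [this]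
        exact ⟨Int.emod_eq_of_lt hc0 hc1, by nlinarith, by nlinarith⟩
    erw [this]
    rw [Real.volume_Ico, add_div, add_sub_cancel_left, one_div, ENNReal.ofReal_inv_of_pos hp,
      ENNReal.ofReal_pow (by norm_num), ENNReal.inv_pow]
    norm_num
  · exact (AddCircle.measurable_mk') hm

theorem lebesgue_dyadicCube (n : ℕ) (k : Fin d → ℤ) :
    lebesgue d (dyadicCube n k) = (2⁻¹ ^ n) ^ d := by
  rw [lebesgue_apply]
  have : WithLp.toLp 2 ⁻¹' dyadicCube n k =
      univ.pi fun i => {a : UnitAddCircle | circleAddr n a = k i % 2 ^ n} := by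
    ext z
    simp [mem_dyadicCube, addr]
  rw [this, volume_pi_pi]
  simp_rw [volume_circleAddr_eq]
  simp

theorem lebesgue_ball_le (z : Torus d) (ε : ℝ) :
    lebesgue d (Metric.ball z ε) ≤ ENNReal.ofReal (2 * ε) ^ d := by
  rw [lebesgue_apply]
  have : WithLp.toLp 2 ⁻¹' Metric.ball z ε ⊆ univ.pi fun i => Metric.closedBall (z i) ε := by
    intro y hy i _
    have hy' : dist (WithLp.toLp 2 y) z < ε := hy
    exact (PiLp.dist_apply_le (p := 2) (WithLp.toLp 2 y) z i).trans hy'.le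
  refine (measure_mono this).trans ?_
  rw [volume_pi_pi]
  simp_rw [AddCircle.volume_closedBall]
  refine (Finset.prod_le_prod' fun i _ => ENNReal.ofReal_le_ofReal (min_le_right _ _)).trans ?_
  simp

/-! ### Distances, and the position of subcubes. -/

theorem exists_coe_abs_sub_eq_dist (u : ℝ) (a : UnitAddCircle) :
    ∃ w : ℝ, (w : UnitAddCircle) = a ∧ |w - u| = dist a (u : UnitAddCircle) := by
  obtain ⟨v, rfl⟩ := QuotientAddGroup.mk_surjective a
  refine ⟨v - round (v - u), ?_, ?_⟩
  · simp
  · change _ = dist (v : UnitAddCircle) (u : UnitAddCircle)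
    rw [dist_eq_norm, ← AddCircle.coe_sub, UnitAddCircle.norm_eq]
    congr 1
    ring

theorem dist_coe_le (u v : ℝ) : dist (u : UnitAddCircle) (v : UnitAddCircle) ≤ |u - v| := by
  rw [dist_eq_norm, ← AddCircle.coe_sub, UnitAddCircle.norm_eq]
  simpa using round_le (u - v) 0

theorem dist_le_sqrt_mul {y z : Torus d} {ε : ℝ} (hε : 0 ≤ ε) (h : ∀ i, dist (y i) (z i) ≤ ε) :
    dist y z ≤ √d * ε := by
  rw [PiLp.dist_eq_of_L2]
  refine Real.sqrt_le_iff.2 ⟨by positivity, ?_⟩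
  rw [mul_pow, Real.sq_sqrt (Nat.cast_nonneg d)]
  refine (Finset.sum_le_sum fun i _ => pow_le_pow_left₀ dist_nonneg (h i) 2).trans ?_
  simp

theorem dist_le_of_mem_dyadicCube {n : ℕ} {k : Fin d → ℤ} {y z : Torus d}
    (hy : y ∈ dyadicCube n k) (hz : z ∈ dyadicCube n k) : dist y z ≤ √d * 2⁻¹ ^ n := by
  obtain ⟨u, hu, rfl⟩ := hy
  obtain ⟨v, hv, rfl⟩ := hz
  refine dist_le_sqrt_mul (by positivity) fun i => (dist_coe_le _ _).trans ?_
  have h1 : u i ∈ Ico _ _ := hu i (mem_univ i)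
  have h2 : v i ∈ Ico _ _ := hv i (mem_univ i)
  rw [mem_Ico, add_div, one_div, ← inv_pow] at h1 h2
  rw [abs_le]
  constructor <;> linarith [h1.1, h1.2, h2.1, h2.2]

instance : CompactSpace (Torus d) :=
  (PiLp.homeomorph 2 (fun _ : Fin d => UnitAddCircle)).symm.compactSpace

/-- In each coordinate the subcube is the second quarter of the side, so it keeps a distance of at
least a quarter side from the complement. Small balls that meet it therefore stay in the large cube.
-/
theorem mem_dyadicCube_of_dist_lt {n : ℕ} {k : Fin d → ℤ} {y z : Torus d}
    (hy : y ∈ dyadicCube (n + 2) fun i => 4 * k i + 1) (h : dist z y < 2⁻¹ ^ (n + 2)) :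
    z ∈ dyadicCube n k := by
  obtain ⟨u, hu, rfl⟩ := hy
  have key := fun i => exists_coe_abs_sub_eq_dist (u i) (z i)
  choose w hw1 hw2 using key
  refine ⟨w, fun i _ => ?_, PiLp.ext hw1⟩
  have hd : |w i - u i| < 2⁻¹ ^ (n + 2) := by
    rw [hw2 i]
    exact (PiLp.dist_apply_le (p := 2) z (proj u) i).trans_lt h
  have h1 : u i ∈ Ico _ _ := hu i (mem_univ i)
  have hp : (0 : ℝ) < 2 ^ n := by positivity
  have hq : (2 : ℝ) ^ (n + 2) = 4 * 2 ^ n := by ring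
  have hk : (k i : ℝ) / 2 ^ n * 2 ^ n = k i := by field_simp
  rw [inv_pow, hq, abs_lt] at hd
  have hinv : ((4 : ℝ) * 2 ^ n)⁻¹ * (4 * 2 ^ n) = 1 := by field_simp
  rw [hq, mem_Ico, div_le_iff₀ (by positivity), lt_div_iff₀ (by positivity)] at h1
  push_cast at h1
  rw [mem_Ico, div_le_iff₀ hp, lt_div_iff₀ hp]
  constructor <;> nlinarith

theorem dyadicCube_child_subset (n : ℕ) (k e : Fin d → ℤ) (h0 : ∀ i, 0 ≤ e i) (h1 : ∀ i, e i < 2) :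
    dyadicCube (n + 1) (fun i => 2 * k i + e i) ⊆ dyadicCube n k := by
  rintro _ ⟨u, hu, rfl⟩
  refine ⟨u, fun i _ => ?_, rfl⟩
  have h := hu i (mem_univ i)
  have hp : (0 : ℝ) < 2 ^ n := by positivity
  have hq : (2 : ℝ) ^ (n + 1) = 2 * 2 ^ n := by ring
  have e0 : (0 : ℝ) ≤ e i := by exact_mod_cast h0 i
  have e1 : (e i : ℝ) + 1 ≤ 2 := by exact_mod_cast h1 i
  rw [hq, mem_Ico, div_le_iff₀ (by positivity), lt_div_iff₀ (by positivity)] at h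
  push_cast at h
  rw [mem_Ico, div_le_iff₀ hp, lt_div_iff₀ hp]
  constructor <;> nlinarith

theorem dyadicCube_child_disjoint (n : ℕ) (k e f : Fin d → ℤ) (he0 : ∀ i, 0 ≤ e i)
    (he1 : ∀ i, e i < 2) (hf0 : ∀ i, 0 ≤ f i) (hf1 : ∀ i, f i < 2) (hef : e ≠ f) :
    Disjoint (dyadicCube (n + 1) fun i => 2 * k i + e i)
      (dyadicCube (n + 1) fun i => 2 * k i + f i) := by
  rw [Set.disjoint_left]
  intro z hz hz'
  rw [mem_dyadicCube] at hz hz'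
  refine hef (funext fun i => ?_)
  have h := (hz i).symm.trans (hz' i)
  have h2 : (2 * k i + e i) % 2 = (2 * k i + f i) % 2 :=
    Int.ModEq.of_dvd (dvd_pow_self 2 n.succ_ne_zero) h
  have := he0 i; have := he1 i; have := hf0 i; have := hf1 i
  omega

/-! ### Diameters compared with volumes. -/

theorem cubeDiam_eq (d n : ℕ) : cubeDiam d n = ENNReal.ofReal (√d) * 2⁻¹ ^ n := by
  rw [cubeDiam, div_eq_mul_inv, ENNReal.ofReal_mul (Real.sqrt_nonneg _),
    ENNReal.ofReal_inv_of_pos (by positivity), ENNReal.ofReal_pow (by norm_num), ENNReal.inv_pow]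
  norm_num

theorem cubeDiam_eq_two_mul (d n : ℕ) : cubeDiam d n = 2 * cubeDiam d (n + 1) := by
  rw [cubeDiam_eq, cubeDiam_eq, pow_succ, mul_left_comm, mul_left_comm 2,
    ENNReal.mul_inv_cancel (by norm_num) (by norm_num), mul_one]

theorem cubeDiam_antitone (d : ℕ) : Antitone (cubeDiam d) :=
  antitone_nat_of_succ_le fun n => by
    rw [cubeDiam_eq_two_mul d n]
    exact le_mul_of_one_le_left zero_le (by norm_num)

theorem cubeDiam_ne_top (d n : ℕ) : cubeDiam d n ≠ ∞ := ENNReal.ofReal_ne_top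

theorem cubeDiam_ne_zero (hd : d ≠ 0) (n : ℕ) : cubeDiam d n ≠ 0 := by
  rw [cubeDiam, Ne, ENNReal.ofReal_eq_zero, not_le]
  have : 0 < d := Nat.pos_of_ne_zero hd
  positivity

theorem cubeDiam_rpow_ne_zero (hd : d ≠ 0) (n : ℕ) (t : ℝ) : cubeDiam d n ^ t ≠ 0 :=
  (ENNReal.rpow_pos (pos_iff_ne_zero.2 (cubeDiam_ne_zero hd n)) (cubeDiam_ne_top d n)).ne'

theorem cubeDiam_rpow_antitone (d : ℕ) {t : ℝ} (ht : 0 ≤ t) : Antitone fun n => cubeDiam d n ^ t :=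
  fun _ _ h => ENNReal.rpow_le_rpow (cubeDiam_antitone d h) ht

theorem cubeDiam_rpow_eq (d n : ℕ) {t : ℝ} (ht : 0 ≤ t) :
    cubeDiam d n ^ t = 2 ^ t * cubeDiam d (n + 1) ^ t := by
  rw [cubeDiam_eq_two_mul, ENNReal.mul_rpow_of_nonneg _ _ ht]

/-- Below a cube, volume decays at least as fast as `|D| ^ t`. -/
theorem volume_mul_cubeDiam_rpow_le {n l : ℕ} (h : n ≤ l) {t : ℝ} (ht : 0 ≤ t) (htd : t ≤ d) :
    ((2⁻¹ : ℝ≥0∞) ^ l) ^ d * cubeDiam d n ^ t ≤ (2⁻¹ ^ n) ^ d * cubeDiam d l ^ t := by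
  induction l, h using Nat.le_induction with
  | base => exact le_rfl
  | succ l _ ih =>
    have h2 : (2⁻¹ : ℝ≥0∞) ^ d * 2 ^ t ≤ 1 := by
      have : (2 : ℝ≥0∞) ^ t ≤ 2 ^ d := by
        rw [← ENNReal.rpow_natCast]
        exact ENNReal.rpow_le_rpow_of_exponent_le (by norm_num) htd
      refine (mul_le_mul_right this _).trans ?_
      rw [← mul_pow, ENNReal.inv_mul_cancel (by norm_num) (by norm_num), one_pow]
    calc ((2⁻¹ : ℝ≥0∞) ^ (l + 1)) ^ d * cubeDiam d n ^ t
        = 2⁻¹ ^ d * ((2⁻¹ ^ l) ^ d * cubeDiam d n ^ t) := by rw [pow_succ, mul_pow]; ring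
      _ ≤ 2⁻¹ ^ d * ((2⁻¹ ^ n) ^ d * cubeDiam d l ^ t) := by gcongr
      _ = (2⁻¹ ^ d * 2 ^ t) * ((2⁻¹ ^ n) ^ d * cubeDiam d (l + 1) ^ t) := by
          rw [cubeDiam_rpow_eq d l ht]; ring
      _ ≤ 1 * ((2⁻¹ ^ n) ^ d * cubeDiam d (l + 1) ^ t) := by gcongr
      _ = _ := one_mul _

/-! ### Cost of covering families. -/

/-- The measure on indices of dyadic cubes that gives mass `|D| ^ t` to each cube `D`. -/
noncomputable def weight (d : ℕ) (t : ℝ) : Measure (ℕ × (Fin d → ℤ)) :=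
  Measure.sum fun c => cubeDiam d c.1 ^ t • Measure.dirac c

theorem weight_apply (t : ℝ) (C : Set (ℕ × (Fin d → ℤ))) :
    weight d t C = ∑' c : C, cubeDiam d c.1.1 ^ t := by
  rw [weight, Measure.sum_apply _ MeasurableSet.of_discrete,
    tsum_subtype C fun c => cubeDiam d c.1 ^ t]
  refine tsum_congr fun c => ?_
  by_cases hc : c ∈ C <;> simp [hc]

theorem dyadicContent_eq (t : ℝ) (E : Set (Torus d)) :
    dyadicContent t E = ⨅ (C : Set (ℕ × (Fin d → ℤ)))
      (_ : E ⊆ ⋃ c ∈ C, dyadicCube c.1 c.2), weight d t C := by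
  simp_rw [dyadicContent, weight_apply]

theorem cubeDiam_rpow_le_weight (t : ℝ) {C : Set (ℕ × (Fin d → ℤ))} {c : ℕ × (Fin d → ℤ)}
    (hc : c ∈ C) : cubeDiam d c.1 ^ t ≤ weight d t C := by
  rw [weight_apply]
  exact ENNReal.le_tsum (f := fun c : C => cubeDiam d c.1.1 ^ t) ⟨c, hc⟩

/-- The members of the family `C` of dyadic cubes that meet the set `A`. -/
def touching (C : Set (ℕ × (Fin d → ℤ))) (A : Set (Torus d)) : Set (ℕ × (Fin d → ℤ)) :=
  {c ∈ C | (dyadicCube c.1 c.2 ∩ A).Nonempty}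

/-- A single cube of level at most `n` would already exhaust the budget. -/
theorem lt_of_mem_touching {t : ℝ} (ht : 0 ≤ t) {C : Set (ℕ × (Fin d → ℤ))} {A : Set (Torus d)}
    {n : ℕ} (hA : weight d t (touching C A) < cubeDiam d n ^ t) {c : ℕ × (Fin d → ℤ)}
    (hc : c ∈ touching C A) : n < c.1 := by
  by_contra! h
  exact absurd (hA.trans_le (cubeDiam_rpow_antitone d ht h))
    (not_lt.2 (cubeDiam_rpow_le_weight t hc))

/-- A member of `C` no larger than a cube it meets lies inside that cube, so it cannot meet two
disjoint ones and is counted at most once. -/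
theorem tsum_weight_touching_le {ι : Type*} [Countable ι] (t : ℝ) {C : Set (ℕ × (Fin d → ℤ))}
    {A : Set (Torus d)} {m : ι → ℕ} {k : ι → Fin d → ℤ}
    (hdisj : Pairwise fun i j => Disjoint (dyadicCube (m i) (k i)) (dyadicCube (m j) (k j)))
    (hA : ∀ i, dyadicCube (m i) (k i) ⊆ A)
    (hlevel : ∀ i, ∀ c ∈ touching C (dyadicCube (m i) (k i)), m i ≤ c.1) :
    ∑' i, weight d t (touching C (dyadicCube (m i) (k i))) ≤ weight d t (touching C A) := by
  refine (tsum_meas_le_meas_iUnion_of_disjoint _ (fun _ => MeasurableSet.of_discrete) ?_).trans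
    (measure_mono ?_)
  · intro i j hij
    refine Set.disjoint_left.2 fun c hi hj => ?_
    obtain ⟨y, hy, hyi⟩ := hi.2
    obtain ⟨z, hz, hzj⟩ := hj.2
    have h1 := dyadicCube_subset_of_mem (hlevel i c hi) hyi hy
    exact Set.disjoint_left.1 (hdisj hij) (h1 hz) hzj
  · refine iUnion_subset fun i c hc => ⟨hc.1, hc.2.mono ?_⟩
    exact inter_subset_inter_right _ (hA i)

/-- A cube that is covered too cheaply has a child that is covered more cheaply still. -/
theorem exists_child_weight_lt {t : ℝ} (ht : 0 ≤ t) {C : Set (ℕ × (Fin d → ℤ))} {n : ℕ}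
    {k : Fin d → ℤ} {δ : ℝ≥0∞} (hδ : δ ≤ 1)
    (h : weight d t (touching C (dyadicCube n k)) < δ * cubeDiam d n ^ t) :
    ∃ l, dyadicCube (n + 1) l ⊆ dyadicCube n k ∧
      weight d t (touching C (dyadicCube (n + 1) l)) <
        (2⁻¹ ^ d * 2 ^ t * δ) * cubeDiam d (n + 1) ^ t := by
  -- Otherwise the `2 ^ d` children, whose costs add up to at most that of the parent, would already
  -- cost `δ * |D| ^ t`.
  by_contra! hcon
  have h1 : weight d t (touching C (dyadicCube n k)) < cubeDiam d n ^ t :=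
    h.trans_le (mul_le_of_le_one_left zero_le hδ)
  let l : (Fin d → Fin 2) → Fin d → ℤ := fun e i => 2 * k i + ((e i : ℕ) : ℤ)
  have hsub : ∀ e, dyadicCube (n + 1) (l e) ⊆ dyadicCube n k := fun e =>
    dyadicCube_child_subset n k _ (fun i => by positivity) fun i => by
      have := (e i).2
      omega
  have hsum := tsum_weight_touching_le (C := C) t (m := fun _ => n + 1) (k := l) ?_ hsub ?_
  · refine absurd (hsum.trans_lt h) (not_lt.2 ?_)
    rw [tsum_fintype]
    refine le_trans ?_ (Finset.sum_le_sum fun e _ => hcon (l e) (hsub e))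
    rw [Finset.sum_const, Finset.card_univ, Fintype.card_fun, Fintype.card_fin, Fintype.card_fin,
      nsmul_eq_mul, cubeDiam_rpow_eq d n ht]
    have : (2 : ℝ≥0∞) ^ d * 2⁻¹ ^ d = 1 := by
      rw [← mul_pow, ENNReal.mul_inv_cancel (by norm_num) (by norm_num), one_pow]
    push_cast
    calc δ * (2 ^ t * cubeDiam d (n + 1) ^ t)
        = (2 ^ d * 2⁻¹ ^ d) * (δ * (2 ^ t * cubeDiam d (n + 1) ^ t)) := by rw [this, one_mul]
      _ ≤ _ := le_of_eq (by ring)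
  · intro e f hef
    refine dyadicCube_child_disjoint n k _ _ (fun i => by positivity)
      (fun i => by have := (e i).2; omega) (fun i => by positivity)
      (fun i => by have := (f i).2; omega) fun h => hef ?_
    funext i
    have := congrFun h i
    exact Fin.ext (by exact_mod_cast this)
  · intro e c hc
    have : c ∈ touching C (dyadicCube n k) :=
      ⟨hc.1, hc.2.mono (inter_subset_inter_right _ (hsub e))⟩
    exact lt_of_mem_touching ht h1 this

/-- A cube that is covered too cheaply has descendants that are covered arbitrarily cheaply. -/
theorem exists_descendant_weight_lt {t : ℝ} (ht : 0 ≤ t) (htd : t < d)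
    {C : Set (ℕ × (Fin d → ℤ))} {n : ℕ} {k : Fin d → ℤ} {δ : ℝ≥0∞} (hδ : δ ≠ 0)
    (h : weight d t (touching C (dyadicCube n k)) < cubeDiam d n ^ t) :
    ∃ m l, n ≤ m ∧ dyadicCube m l ⊆ dyadicCube n k ∧
      weight d t (touching C (dyadicCube m l)) < δ * cubeDiam d m ^ t := by
  set q : ℝ≥0∞ := 2⁻¹ ^ d * 2 ^ t with hq
  -- The relative cost gains the factor `2 ^ (t - d)` per generation.
  have hq1 : q < 1 := by
    have h2 : (2 : ℝ≥0∞) ^ t < 2 ^ d := by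
      rw [← ENNReal.rpow_natCast]
      exact ENNReal.rpow_lt_rpow_of_exponent_lt (by norm_num) (by norm_num) htd
    have h3 : (2⁻¹ : ℝ≥0∞) ^ d * 2 ^ d = 1 := by
      rw [← mul_pow, ENNReal.inv_mul_cancel (by norm_num) (by norm_num), one_pow]
    rw [hq, ← h3]
    refine ENNReal.mul_lt_mul_right ?_ ?_ h2
    · simp
    · exact ENNReal.pow_ne_top (by norm_num)
  have key : ∀ N : ℕ, ∃ l, dyadicCube (n + N) l ⊆ dyadicCube n k ∧
      weight d t (touching C (dyadicCube (n + N) l)) < q ^ N * cubeDiam d (n + N) ^ t := by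
    intro N
    induction N with
    | zero => exact ⟨k, subset_rfl, by simpa using h⟩
    | succ N ih =>
      obtain ⟨l, hl, hw⟩ := ih
      obtain ⟨l', hl', hw'⟩ := exists_child_weight_lt ht (pow_le_one' hq1.le N) hw
      exact ⟨l', hl'.trans hl, by rwa [pow_succ']⟩
  obtain ⟨N, hN⟩ := ((ENNReal.tendsto_pow_atTop_nhds_zero_of_lt_one hq1).eventually
    (gt_mem_nhds (pos_iff_ne_zero.2 hδ))).exists
  obtain ⟨l, hl, hw⟩ := key N
  exact ⟨n + N, l, Nat.le_add_right _ _, hl, hw.trans_le (by gcongr)⟩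

/-! ### The covering argument. -/

/-- If all the cubes of level `p j` around the centres `x j` are expensive to cover, then the
balls `B (x j, r j)` have small total volume. -/
theorem lebesgue_iUnion_ball_mul_le {t : ℝ} (ht : 0 ≤ t) (htd : t ≤ d)
    {C : Set (ℕ × (Fin d → ℤ))} {n : ℕ} {k : Fin d → ℤ}
    (hD : weight d t (touching C (dyadicCube n k)) < cubeDiam d n ^ t)
    (x : ℕ → Torus d) (r : ℕ → ℝ) (J : Set ℕ) (q p : ℕ → ℕ)
    (hx : ∀ j ∈ J, x j ∈ dyadicCube n k) (hnq : ∀ j ∈ J, n ≤ q j) (hqp : ∀ j ∈ J, q j ≤ p j)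
    (hr : ∀ j ∈ J, r j ≤ 2⁻¹ ^ q j)
    (hvol : ∀ j ∈ J, ((2⁻¹ : ℝ≥0∞) ^ q j) ^ d * cubeDiam d n ^ t ≤
      (2⁻¹ ^ n) ^ d * cubeDiam d (p j) ^ t)
    (hP : ∀ j ∈ J, cubeDiam d (p j) ^ t ≤
      weight d t (touching C (dyadicCube (p j) (addr (p j) (x j))))) :
    lebesgue d (⋃ j ∈ J, Metric.ball (x j) (r j)) * cubeDiam d n ^ t ≤
      2 * ENNReal.ofReal (2 * (3 * √d + 2)) ^ d *
        ((2⁻¹ ^ n) ^ d * weight d t (touching C (dyadicCube n k))) := by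
  let Q : ℕ → Set (Torus d) := fun j => dyadicCube (q j) (addr (q j) (x j))
  have hxQ : ∀ j, x j ∈ Q j := fun j => self_mem_dyadicCube_addr _ _
  have hQD : ∀ j ∈ J, Q j ⊆ dyadicCube n k := fun j hj =>
    dyadicCube_subset_of_mem (hnq j hj) (hx j hj) (hxQ j)
  -- Selecting disjoint dyadic cubes rather than balls lets their costs be added.
  obtain ⟨M, hMJ, hMd, hM⟩ := Vitali.exists_disjoint_subfamily_covering_enlargement Q J
    (fun j => (2⁻¹ : ℝ) ^ q j) 2 one_lt_two (fun _ _ => by positivity) 1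
    (fun _ _ => pow_le_one₀ (by norm_num) (by norm_num)) (fun j _ => ⟨x j, hxQ j⟩)
  -- In units of the side of `Q b`, the route from `y` through `x a` and `z` to `x b` is at most `2
  -- + 2√d + √d`.
  have hcover : ⋃ j ∈ J, Metric.ball (x j) (r j) ⊆
      ⋃ b : M, Metric.ball (x b) ((3 * √d + 2) * 2⁻¹ ^ q b) := by
    refine iUnion₂_subset fun a ha y hy => ?_
    obtain ⟨b, hb, ⟨z, hza, hzb⟩, hab⟩ := hM a ha
    refine mem_iUnion.2 ⟨⟨b, hb⟩, ?_⟩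
    rw [Metric.mem_ball] at hy ⊢
    have h1 := dist_le_of_mem_dyadicCube (hxQ a) hza
    have h2 := dist_le_of_mem_dyadicCube hzb (hxQ b)
    have h3 := hr a ha
    have h4 : √(d : ℝ) * 2⁻¹ ^ q a ≤ √d * (2 * 2⁻¹ ^ q b) := by gcongr
    have h5 := dist_triangle4 y (x a) z (x b)
    dsimp only at hab ⊢
    linarith
  set K : ℝ≥0∞ := ENNReal.ofReal (2 * (3 * √d + 2)) ^ d with hK
  have hball : ∀ b : M, lebesgue d (Metric.ball (x b) ((3 * √d + 2) * 2⁻¹ ^ q b)) ≤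
      K * (2⁻¹ ^ q b) ^ d := by
    intro b
    refine (lebesgue_ball_le _ _).trans (le_of_eq ?_)
    rw [hK, ← mul_pow, ← mul_assoc, ENNReal.ofReal_mul (by positivity),
      ENNReal.ofReal_pow (by norm_num), ENNReal.ofReal_inv_of_pos (by norm_num)]
    norm_num
  -- For `b` in `M₁` the cube `Q b` is swallowed by a member of `C`, whose volume its own cost
  -- controls. For `b` in `M₂` the members of `C` that meet `Q b` are strictly smaller than it;
  -- their costs add up over `b`, and expensiveness bounds each sum from below.
  let M₁ : Set ℕ := {b ∈ M | ∃ c ∈ C, c.1 ≤ q b ∧ x b ∈ dyadicCube c.1 c.2}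
  let M₂ : Set ℕ := M \ M₁
  have hM₁ : (∑' b : M₁, ((2⁻¹ : ℝ≥0∞) ^ q b) ^ d) * cubeDiam d n ^ t ≤
      (2⁻¹ ^ n) ^ d * weight d t (touching C (dyadicCube n k)) := by
    have h1 : ∑' b : M₁, ((2⁻¹ : ℝ≥0∞) ^ q b) ^ d = lebesgue d (⋃ b ∈ M₁, Q b) := by
      rw [measure_biUnion M₁.to_countable (hMd.subset fun b hb => hb.1)
        fun b _ => measurableSet_dyadicCube _ _]
      simp_rw [Q, lebesgue_dyadicCube]
    have h2 : ⋃ b ∈ M₁, Q b ⊆ ⋃ c : touching C (dyadicCube n k), dyadicCube c.1.1 c.1.2 := by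
      refine iUnion₂_subset fun b hb => ?_
      obtain ⟨hbM, c, hcC, hcq, hxc⟩ := hb
      refine (dyadicCube_subset_of_mem hcq hxc (hxQ b)).trans ?_
      exact subset_iUnion (fun c : touching C (dyadicCube n k) => dyadicCube c.1.1 c.1.2)
        ⟨c, hcC, x b, hxc, hx b (hMJ hbM)⟩
    rw [h1]
    calc _ ≤ (∑' c : touching C (dyadicCube n k), ((2⁻¹ : ℝ≥0∞) ^ c.1.1) ^ d) *
          cubeDiam d n ^ t := by
          gcongr
          refine ((measure_mono h2).trans (measure_iUnion_le _)).trans (le_of_eq ?_)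
          simp_rw [lebesgue_dyadicCube]
      _ ≤ _ := by
          rw [weight_apply, ← ENNReal.tsum_mul_right, ← ENNReal.tsum_mul_left]
          exact ENNReal.tsum_le_tsum fun c =>
            volume_mul_cubeDiam_rpow_le (lt_of_mem_touching ht hD c.2).le ht htd
  have hM₂ : (∑' b : M₂, ((2⁻¹ : ℝ≥0∞) ^ q b) ^ d) * cubeDiam d n ^ t ≤
      (2⁻¹ ^ n) ^ d * weight d t (touching C (dyadicCube n k)) := by
    rw [← ENNReal.tsum_mul_right]
    calc _ ≤ ∑' b : M₂, (2⁻¹ ^ n) ^ d * weight d t (touching C (Q b)) := by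
          refine ENNReal.tsum_le_tsum fun b => ?_
          have hbJ := hMJ b.2.1
          refine (hvol b hbJ).trans ?_
          gcongr
          refine (hP b hbJ).trans (measure_mono fun c hc => ⟨hc.1, hc.2.mono ?_⟩)
          exact inter_subset_inter_right _ (dyadicCube_subset_of_mem (hqp b hbJ) (hxQ b)
            (self_mem_dyadicCube_addr _ _))
      _ ≤ _ := by
          rw [ENNReal.tsum_mul_left]
          gcongr
          refine tsum_weight_touching_le t (m := fun b : M₂ => q b)
            (k := fun b : M₂ => addr (q b) (x b)) ?_ (fun b => hQD b (hMJ b.2.1)) ?_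
          · exact fun a b hab => hMd a.2.1 b.2.1 fun h => hab (Subtype.ext h)
          · intro b c hc
            by_contra! hlt
            obtain ⟨y, hyc, hyb⟩ := hc.2
            exact b.2.2 ⟨b.2.1, c, hc.1, hlt.le,
              dyadicCube_subset_of_mem hlt.le hyc hyb (hxQ b)⟩
  have hsplit : ∑' b : M, ((2⁻¹ : ℝ≥0∞) ^ q b) ^ d ≤
      ∑' b : M₁, ((2⁻¹ : ℝ≥0∞) ^ q b) ^ d + ∑' b : M₂, ((2⁻¹ : ℝ≥0∞) ^ q b) ^ d := by
    have : M ⊆ M₁ ∪ M₂ := fun b hb => by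
      by_cases h : b ∈ M₁
      exacts [Or.inl h, Or.inr ⟨hb, h⟩]
    exact (ENNReal.tsum_mono_subtype (fun b => ((2⁻¹ : ℝ≥0∞) ^ q b) ^ d) this).trans
      (ENNReal.tsum_union_le (fun b => ((2⁻¹ : ℝ≥0∞) ^ q b) ^ d) _ _)
  calc _ ≤ (∑' b : M, K * ((2⁻¹ : ℝ≥0∞) ^ q b) ^ d) * cubeDiam d n ^ t := by
        gcongr
        exact (measure_mono hcover).trans ((measure_iUnion_le _).trans (ENNReal.tsum_le_tsum hball))
    _ ≤ K * ((∑' b : M₁, ((2⁻¹ : ℝ≥0∞) ^ q b) ^ d + ∑' b : M₂, ((2⁻¹ : ℝ≥0∞) ^ q b) ^ d) *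
          cubeDiam d n ^ t) := by
        rw [ENNReal.tsum_mul_left, mul_assoc]
        gcongr
    _ ≤ K * ((2⁻¹ ^ n) ^ d * weight d t (touching C (dyadicCube n k)) +
          (2⁻¹ ^ n) ^ d * weight d t (touching C (dyadicCube n k))) := by
        rw [add_mul]
        gcongr
    _ = _ := by ring

theorem rpow_le_self_of_le_one {d : ℕ} {s r : ℝ} (hs : 0 < s) (hsd : s ≤ d) (hr : 0 < r)
    (hr1 : r ≤ 1) : r ^ ((d : ℝ) / s) ≤ r := by
  calc r ^ ((d : ℝ) / s) ≤ r ^ (1 : ℝ) :=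
        Real.rpow_le_rpow_of_exponent_ge hr hr1 ((one_le_div hs).2 hsd)
    _ = r := Real.rpow_one r

/-- Comparison of the volume at scale `r` with `|D| ^ t` at scale `r ^ (d / s)`. -/
theorem eventually_volume_le {s t : ℝ} (ht : 0 ≤ t) (hts : t < s)
    (hsd : s ≤ d) {r : ℕ → ℝ} (hr : ∀ j, 0 < r j) (hr0 : Tendsto r atTop (𝓝 0)) (n : ℕ) :
    ∀ᶠ j in atTop, ∀ q p : ℕ, (2⁻¹ : ℝ) ^ (q + 1) < r j →
      r j ^ ((d : ℝ) / s) ≤ 4 * (√d * 2⁻¹ ^ p) →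
      ((2⁻¹ : ℝ≥0∞) ^ q) ^ d * cubeDiam d n ^ t ≤ (2⁻¹ ^ n) ^ d * cubeDiam d p ^ t := by
  have hs : 0 < s := ht.trans_lt hts
  have hd : (0 : ℝ) < d := hs.trans_le hsd
  -- With `ρ = r ^ (d / s)` the volume at scale `r` is about `ρ ^ s = ρ ^ (s - t) * ρ ^ t`; the
  -- spare factor `ρ ^ (s - t)` absorbs every constant.
  have hlim : Tendsto (fun j => 2 ^ d * (√d / 2 ^ n) ^ t * 4 ^ t * (r j ^ ((d : ℝ) / s)) ^ (s - t))
      atTop (𝓝 0) := by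
    have h1 : Tendsto (fun j => r j ^ ((d : ℝ) / s)) atTop (𝓝 0) := by
      simpa [Real.zero_rpow (div_pos hd hs).ne'] using
        hr0.rpow_const (p := (d : ℝ) / s) (Or.inr (div_pos hd hs).le)
    have h2 := h1.rpow_const (p := s - t) (Or.inr (sub_pos.2 hts).le)
    rw [Real.zero_rpow (sub_pos.2 hts).ne'] at h2
    simpa using h2.const_mul (2 ^ d * (√d / 2 ^ n) ^ t * 4 ^ t)
  have hpos : (0 : ℝ) < (2⁻¹ ^ n) ^ d := by positivity
  filter_upwards [hlim.eventually (gt_mem_nhds hpos)] with j hj q p hq hp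
  set ρ := r j ^ ((d : ℝ) / s) with hρ
  have hρ0 : 0 < ρ := Real.rpow_pos_of_pos (hr j) _
  have hρs : ρ ^ s = r j ^ d := by
    rw [hρ, ← Real.rpow_mul (hr j).le, div_mul_cancel₀ _ hs.ne', Real.rpow_natCast]
  have hreal : ((2⁻¹ : ℝ) ^ q) ^ d * (√d / 2 ^ n) ^ t ≤ (2⁻¹ ^ n) ^ d * (√d / 2 ^ p) ^ t := by
    have h1 : ((2⁻¹ : ℝ) ^ q) ^ d ≤ 2 ^ d * ρ ^ s := by
      rw [hρs, ← mul_pow]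
      refine pow_le_pow_left₀ (by positivity) ?_ d
      rw [pow_succ] at hq
      linarith
    have h2 : ρ ^ t ≤ 4 ^ t * (√d / 2 ^ p) ^ t := by
      rw [← Real.mul_rpow (by norm_num) (by positivity)]
      refine Real.rpow_le_rpow hρ0.le ?_ ht
      rwa [div_eq_mul_inv, ← inv_pow]
    have h3 : ρ ^ s = ρ ^ (s - t) * ρ ^ t := by
      rw [← Real.rpow_add hρ0, sub_add_cancel]
    calc ((2⁻¹ : ℝ) ^ q) ^ d * (√d / 2 ^ n) ^ t
        ≤ (2 ^ d * (ρ ^ (s - t) * ρ ^ t)) * (√d / 2 ^ n) ^ t := by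
          rw [← h3]; gcongr
      _ ≤ (2 ^ d * (ρ ^ (s - t) * (4 ^ t * (√d / 2 ^ p) ^ t))) * (√d / 2 ^ n) ^ t := by gcongr
      _ = (2 ^ d * (√d / 2 ^ n) ^ t * 4 ^ t * ρ ^ (s - t)) * (√d / 2 ^ p) ^ t := by ring
      _ ≤ _ := by gcongr
  have conv : ∀ a b : ℕ, ((2⁻¹ : ℝ≥0∞) ^ a) ^ d * cubeDiam d b ^ t =
      ENNReal.ofReal (((2⁻¹ : ℝ) ^ a) ^ d * (√d / 2 ^ b) ^ t) := by
    intro a b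
    rw [ENNReal.ofReal_mul (by positivity), cubeDiam,
      ENNReal.ofReal_rpow_of_nonneg (by positivity) ht, ENNReal.ofReal_pow (by positivity),
      ENNReal.ofReal_pow (by positivity), ENNReal.ofReal_inv_of_pos (by norm_num)]
    norm_num
  rw [conv, conv]
  exact ENNReal.ofReal_le_ofReal hreal

/-! ### Cheap cubes inside shrunken balls. -/

/-- A cube that is covered too cheaply contains a smaller one, inside some ball
`B (x j, r j ^ (d / s))`, that is also covered too cheaply. -/
theorem exists_cube_in_ball_weight_lt {x : ℕ → Torus d} {r : ℕ → ℝ} (hr : ∀ j, 0 < r j)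
    (hfull : lebesgue d (limsup (fun j => Metric.ball (x j) (r j)) atTop)ᶜ = 0)
    (hr0 : Tendsto r atTop (𝓝 0)) {s t : ℝ} (hsd : s ≤ d) (ht : 0 ≤ t) (hts : t < s)
    {C : Set (ℕ × (Fin d → ℤ))} {n : ℕ} {k : Fin d → ℤ}
    (hD : weight d t (touching C (dyadicCube n k)) < cubeDiam d n ^ t) (N : ℕ) :
    ∃ m l, n < m ∧ closure (dyadicCube m l) ⊆ dyadicCube n k ∧
      (∃ j, N ≤ j ∧ closure (dyadicCube m l) ⊆ Metric.ball (x j) (r j ^ ((d : ℝ) / s))) ∧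
      weight d t (touching C (dyadicCube m l)) < cubeDiam d m ^ t := by
  have hs : 0 < s := ht.trans_lt hts
  have hd : (0 : ℝ) < d := hs.trans_le hsd
  have hd0 : d ≠ 0 := fun h => by simp [h] at hd
  have hd1 : 1 ≤ √(d : ℝ) := Real.one_le_sqrt.2 (by exact_mod_cast Nat.pos_of_ne_zero hd0)
  set K : ℝ≥0∞ := 2 * ENNReal.ofReal (2 * (3 * √d + 2)) ^ d with hK
  have hK0 : K ≠ 0 := by
    refine mul_ne_zero two_ne_zero (pow_ne_zero _ ?_)
    rw [Ne, ENNReal.ofReal_eq_zero, not_le]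
    positivity
  have hKt : K ≠ ∞ := ENNReal.mul_ne_top (by norm_num) (ENNReal.pow_ne_top ENNReal.ofReal_ne_top)
  -- `K` is the constant of the covering argument and `4 ^ (-d)` the share of the volume taken by
  -- the inner cube `G` below; thus `K * δ` is exactly that share.
  set δ : ℝ≥0∞ := (2⁻¹ ^ 2) ^ d / K with hδ
  have hδ0 : δ ≠ 0 := by
    refine (ENNReal.div_pos ?_ hKt).ne'
    simp
  obtain ⟨n', k', hnn', hsub, hlt⟩ := exists_descendant_weight_lt ht (hts.trans_le hsd) hδ0 hD
  have hlt1 : weight d t (touching C (dyadicCube n' k')) < cubeDiam d n' ^ t := by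
    refine hlt.trans_le (mul_le_of_le_one_left zero_le ?_)
    refine ENNReal.div_le_of_le_mul ?_
    rw [one_mul]
    calc ((2⁻¹ : ℝ≥0∞) ^ 2) ^ d ≤ 1 :=
          pow_le_one' (pow_le_one' (ENNReal.inv_le_one.2 (by norm_num)) _) _
      _ ≤ K := by
        refine one_le_mul (by norm_num) (one_le_pow₀ ?_)
        rw [ENNReal.one_le_ofReal]
        linarith
  -- Then `2 * r j < 2⁻¹ ^ (n' + 2)`, the margin of `G` in the large cube.
  have hsmall : ∀ᶠ j in atTop, r j < 2⁻¹ ^ (n' + 3) := hr0.eventually (gt_mem_nhds (by positivity))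
  obtain ⟨N₀, hN₀⟩ := eventually_atTop.1 (hsmall.and (eventually_volume_le ht hts hsd hr hr0 n'))
  have hr1 : ∀ j, N₀ ≤ j → r j ≤ 1 := fun j hj =>
    (hN₀ j hj).1.le.trans (pow_le_one₀ (by norm_num) (by norm_num))
  have hρr : ∀ j, N₀ ≤ j → r j ^ ((d : ℝ) / s) ≤ r j := fun j hj =>
    rpow_le_self_of_le_one hs hsd (hr j) (hr1 j hj)
  have hρ0 : ∀ j, 0 < r j ^ ((d : ℝ) / s) := fun j => Real.rpow_pos_of_pos (hr j) _
  have hq : ∀ j, ∃ q, N₀ ≤ j → (2⁻¹ : ℝ) ^ (q + 1) < r j ∧ r j ≤ 2⁻¹ ^ q := by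
    intro j
    by_cases hj : N₀ ≤ j
    · obtain ⟨q, hq⟩ := exists_nat_pow_near_of_lt_one (hr j) (hr1 j hj)
        (by norm_num : (0 : ℝ) < 2⁻¹) (by norm_num)
      exact ⟨q, fun _ => hq⟩
    · exact ⟨0, fun h => absurd h hj⟩
  -- The diameter is below half the shrunken radius, so even the closed cube fits in the ball, yet
  -- it is at least a quarter of that radius. Indices below `N₀` get the dummy level `0`.
  have hp : ∀ j, ∃ p, N₀ ≤ j → √d * 2⁻¹ ^ p < r j ^ ((d : ℝ) / s) / 2 ∧
      r j ^ ((d : ℝ) / s) ≤ 4 * (√d * 2⁻¹ ^ p) := by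
    intro j
    by_cases hj : N₀ ≤ j
    · have hη : 0 < r j ^ ((d : ℝ) / s) / 2 / √d := by have := hρ0 j; positivity
      have hη1 : r j ^ ((d : ℝ) / s) / 2 / √d ≤ 1 := by
        rw [div_le_one (by positivity)]
        linarith [hρr j hj, hr1 j hj]
      obtain ⟨p, hp1, hp2⟩ := exists_nat_pow_near_of_lt_one hη hη1
        (by norm_num : (0 : ℝ) < 2⁻¹) (by norm_num)
      rw [lt_div_iff₀' (by positivity)] at hp1
      rw [div_le_iff₀' (by positivity)] at hp2
      refine ⟨p + 1, fun _ => ⟨hp1, ?_⟩⟩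
      rw [pow_succ]
      linarith
    · exact ⟨0, fun h => absurd h hj⟩
  choose q hq using hq
  choose p hp using hp
  have hnq : ∀ j, N₀ ≤ j → n' ≤ q j := by
    intro j hj
    have h := (hq j hj).1.trans (hN₀ j hj).1
    rw [pow_lt_pow_iff_right_of_lt_one₀ (by norm_num) (by norm_num)] at h
    omega
  have hqp : ∀ j, N₀ ≤ j → q j < p j := by
    intro j hj
    have h : (2⁻¹ : ℝ) ^ p j < 2⁻¹ ^ q j := by
      have h1 : (2⁻¹ : ℝ) ^ p j ≤ √d * 2⁻¹ ^ p j := le_mul_of_one_le_left (by positivity) hd1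
      linarith [(hp j hj).1, hρr j hj, (hq j hj).2, hr j]
    rwa [pow_lt_pow_iff_right_of_lt_one₀ (by norm_num) (by norm_num)] at h
  set G : Set (Torus d) := dyadicCube (n' + 2) fun i => 4 * k' i + 1 with hG
  let J : Set ℕ := {j | max N N₀ ≤ j ∧ (Metric.ball (x j) (r j) ∩ G).Nonempty}
  have hJ0 : ∀ j ∈ J, N₀ ≤ j := fun j hj => (le_max_right _ _).trans hj.1
  have hpow : (2⁻¹ : ℝ) ^ (n' + 2) = 2 * 2⁻¹ ^ (n' + 3) := by rw [pow_succ _ (n' + 2)]; ring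
  have hnear : ∀ j ∈ J, ∀ y, dist y (x j) ≤ r j → y ∈ dyadicCube n' k' := by
    intro j hj y hy
    obtain ⟨g, hgb, hg⟩ := hj.2
    refine mem_dyadicCube_of_dist_lt hg ?_
    rw [Metric.mem_ball'] at hgb
    have := dist_triangle y (x j) g
    have := (hN₀ j (hJ0 j hj)).1
    linarith
  have hclosure : ∀ j ∈ J, closure (dyadicCube (p j) (addr (p j) (x j))) ⊆
      Metric.closedBall (x j) (√d * 2⁻¹ ^ p j) := fun j _ =>
    closure_minimal (fun y hy => dist_le_of_mem_dyadicCube hy (self_mem_dyadicCube_addr _ _))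
      Metric.isClosed_closedBall
  -- Now every cube of level `p j` around `x j`, `j ∈ J`, must be expensive.
  by_contra! hcon
  have hmain := lebesgue_iUnion_ball_mul_le ht (hts.le.trans hsd) hlt1 x r J q p
    (fun j hj => hnear j hj _ (by simpa using (hr j).le)) (fun j hj => hnq j (hJ0 j hj))
    (fun j hj => (hqp j (hJ0 j hj)).le) (fun j hj => (hq j (hJ0 j hj)).2)
    (fun j hj => (hN₀ j (hJ0 j hj)).2 _ _ (hq j (hJ0 j hj)).1 (hp j (hJ0 j hj)).2) ?_
  -- Almost every point of `G` lies in balls of arbitrarily large index, and those balls meet `G`.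
  · have hGJ : lebesgue d G ≤ lebesgue d (⋃ j ∈ J, Metric.ball (x j) (r j)) := by
      refine (measure_mono (t := (⋃ j ∈ J, Metric.ball (x j) (r j)) ∪
        (limsup (fun j => Metric.ball (x j) (r j)) atTop)ᶜ) fun z hz => ?_).trans
        ((measure_union_le _ _).trans (by rw [hfull, add_zero]))
      by_cases hzE : z ∈ limsup (fun j => Metric.ball (x j) (r j)) atTop
      · obtain ⟨j, hj, hzj⟩ := (mem_limsup_iff_frequently_mem.1 hzE).forall_exists_of_atTop
          (max N N₀)
        exact Or.inl (mem_biUnion (show j ∈ J from ⟨hj, z, hzj, hz⟩) hzj)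
      · exact Or.inr hzE
    have hvn : ((2⁻¹ : ℝ≥0∞) ^ n') ^ d ≠ 0 := by simp
    have hvt : ((2⁻¹ : ℝ≥0∞) ^ n') ^ d ≠ ∞ :=
      ENNReal.pow_ne_top (ENNReal.pow_ne_top (by norm_num))
    refine absurd (lt_of_le_of_lt (le_trans (mul_le_mul_left hGJ _) hmain) ?_) (lt_irrefl
      (lebesgue d G * cubeDiam d n' ^ t))
    calc K * ((2⁻¹ ^ n') ^ d * weight d t (touching C (dyadicCube n' k')))
        < K * ((2⁻¹ ^ n') ^ d * (δ * cubeDiam d n' ^ t)) :=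
          ENNReal.mul_lt_mul_right hK0 hKt (ENNReal.mul_lt_mul_right hvn hvt hlt)
      _ = (K * δ) * ((2⁻¹ ^ n') ^ d * cubeDiam d n' ^ t) := by ring
      _ = _ := by
          rw [hδ, ENNReal.mul_div_cancel hK0 hKt, hG, lebesgue_dyadicCube, pow_add, mul_pow]
          ring
  · intro j hj
    refine hcon _ _ ?_ ?_ ⟨j, ?_, ?_⟩
    · exact hnn'.trans_lt ((hnq j (hJ0 j hj)).trans_lt (hqp j (hJ0 j hj)))
    · refine (hclosure j hj).trans fun y hy => hsub (hnear j hj y ?_)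
      rw [Metric.mem_closedBall] at hy
      linarith [(hp j (hJ0 j hj)).1, hρr j (hJ0 j hj), hr j]
    · exact (le_max_left _ _).trans hj.1
    · refine (hclosure j hj).trans (Metric.closedBall_subset_ball ?_)
      linarith [(hp j (hJ0 j hj)).1, hρ0 j]

/-! ### Content of the limsup set. -/

theorem isGδ_limsup_ball (x : ℕ → Torus d) (ρ : ℕ → ℝ) :
    IsGδ (limsup (fun j => Metric.ball (x j) (ρ j)) atTop) := by
  rw [limsup_eq_iInf_iSup_of_nat]
  simp only [iInf_eq_iInter, iSup_eq_iUnion]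
  exact IsGδ.iInter_of_isOpen fun n => isOpen_iUnion fun i => isOpen_iUnion fun _ =>
    Metric.isOpen_ball

/-- The content of the limsup set of shrunken balls is full in every dyadic cube. -/
theorem cubeDiam_rpow_le_dyadicContent {x : ℕ → Torus d} {r : ℕ → ℝ} (hr : ∀ j, 0 < r j)
    (hfull : lebesgue d (limsup (fun j => Metric.ball (x j) (r j)) atTop)ᶜ = 0)
    (hr0 : Tendsto r atTop (𝓝 0)) {s t : ℝ} (hsd : s ≤ d) (ht : 0 ≤ t) (hts : t < s)
    (n : ℕ) (k : Fin d → ℤ) :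
    cubeDiam d n ^ t ≤ dyadicContent t
      (limsup (fun j => Metric.ball (x j) (r j ^ ((d : ℝ) / s))) atTop ∩ dyadicCube n k) := by
  rw [dyadicContent_eq]
  refine le_iInf₂ fun C hC => ?_
  by_contra! hlt
  let σ := {c : ℕ × (Fin d → ℤ) //
    weight d t (touching C (dyadicCube c.1 c.2)) < cubeDiam d c.1 ^ t}
  have step : ∀ (i : ℕ) (c : σ), ∃ c' : σ, c.1.1 < c'.1.1 ∧
      closure (dyadicCube c'.1.1 c'.1.2) ⊆ dyadicCube c.1.1 c.1.2 ∧
      ∃ j, i ≤ j ∧ closure (dyadicCube c'.1.1 c'.1.2) ⊆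
        Metric.ball (x j) (r j ^ ((d : ℝ) / s)) := by
    intro i c
    obtain ⟨m, l, h1, h2, h3, h4⟩ :=
      exists_cube_in_ball_weight_lt hr hfull hr0 hsd ht hts c.2 i
    exact ⟨⟨(m, l), h4⟩, h1, h2, h3⟩
  choose g hg₁ hg₂ hg₃ using step
  let c₀ : σ := ⟨(n, k), (measure_mono (sep_subset _ _)).trans_lt hlt⟩
  -- Step `i` picks a ball of index at least `i`, so a point in all the cubes lies in infinitely
  -- many balls.
  let f : ℕ → σ := fun i => Nat.rec c₀ g i
  have hf₁ : ∀ i, i ≤ (f i).1.1 := by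
    intro i
    induction i with
    | zero => exact Nat.zero_le _
    | succ i ih => exact ih.trans_lt (hg₁ i (f i))
  let P : ℕ → Set (Torus d) := fun i => dyadicCube (f i).1.1 (f i).1.2
  have hP : ∀ i, closure (P (i + 1)) ⊆ P i := fun i => hg₂ i (f i)
  obtain ⟨z, hz⟩ := IsCompact.nonempty_iInter_of_sequence_nonempty_isCompact_isClosed
    (fun i => closure (P i)) (fun i => (hP i).trans subset_closure)
    (fun i => (dyadicCube_nonempty _ _).closure) isClosed_closure.isCompact
    fun i => isClosed_closure
  have hz' : ∀ i, z ∈ closure (P i) := mem_iInter.1 hz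
  have hzP : ∀ i, z ∈ P i := fun i => hP i (hz' (i + 1))
  have hzE : z ∈ limsup (fun j => Metric.ball (x j) (r j ^ ((d : ℝ) / s))) atTop := by
    refine mem_limsup_iff_frequently_mem.2 (frequently_atTop.2 fun i => ?_)
    obtain ⟨j, hij, hj⟩ := hg₃ i (f i)
    exact ⟨j, hij, hj (hz' (i + 1))⟩
  obtain ⟨c, hcC, hzc⟩ := mem_iUnion₂.1 (hC ⟨hzE, hzP 0⟩)
  have hc : c ∈ touching C (P c.1) := ⟨hcC, z, hzc, hzP _⟩
  exact absurd (lt_of_mem_touching ht (f c.1).2 hc) (not_lt.2 (hf₁ c.1))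

/-! ### From content to Hausdorff dimension. -/

theorem lebesgue_mul_le_dyadicContent {t : ℝ} (ht : 0 ≤ t) (htd : t ≤ d) (E : Set (Torus d)) :
    lebesgue d E * cubeDiam d 0 ^ t ≤ dyadicContent t E := by
  rw [dyadicContent_eq]
  refine le_iInf₂ fun C hC => ?_
  have h : lebesgue d E ≤ ∑' c : C, ((2⁻¹ : ℝ≥0∞) ^ c.1.1) ^ d := by
    rw [biUnion_eq_iUnion] at hC
    refine ((measure_mono hC).trans (measure_iUnion_le _)).trans (le_of_eq ?_)
    simp_rw [lebesgue_dyadicCube]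
  rw [weight_apply]
  refine (mul_le_mul_left h _).trans ?_
  rw [← ENNReal.tsum_mul_right]
  refine ENNReal.tsum_le_tsum fun c => ?_
  simpa using volume_mul_cubeDiam_rpow_le (Nat.zero_le c.1.1) ht htd

theorem lebesgue_ball_ne_zero (a : Torus d) {ε : ℝ} (hε : 0 < ε) :
    lebesgue d (Metric.ball a ε) ≠ 0 := by
  have hlim : Tendsto (fun n : ℕ => √(d : ℝ) * 2⁻¹ ^ n) atTop (𝓝 0) := by
    simpa using (tendsto_pow_atTop_nhds_zero_of_lt_one (r := (2⁻¹ : ℝ)) (by norm_num)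
      (by norm_num)).const_mul (√(d : ℝ))
  obtain ⟨n, hn⟩ := (hlim.eventually (gt_mem_nhds hε)).exists
  have hsub : dyadicCube n (addr n a) ⊆ Metric.ball a ε := fun y hy =>
    (dist_le_of_mem_dyadicCube hy (self_mem_dyadicCube_addr n a)).trans_lt hn
  refine (lt_of_lt_of_le ?_ (measure_mono hsub)).ne'
  rw [lebesgue_dyadicCube, pos_iff_ne_zero]
  simp

/-- A set of diameter at most `2 ^ (-n)` meets at most `3 ^ d` dyadic cubes of level `n`. -/
theorem exists_cover_of_dist_le {S : Set (Torus d)} {y : Torus d} {n : ℕ} (t : ℝ)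
    (hS : ∀ z ∈ S, dist z y ≤ 2⁻¹ ^ n) :
    ∃ F : Set (ℕ × (Fin d → ℤ)), S ⊆ ⋃ c ∈ F, dyadicCube c.1 c.2 ∧
      weight d t F ≤ 3 ^ d * cubeDiam d n ^ t := by
  -- The offsets `-1, 0, 1` from the address of `y`, in each coordinate.
  let φ : (Fin d → Fin 3) → ℕ × (Fin d → ℤ) := fun v =>
    (n, fun i => addr n y i + ((v i : ℕ) : ℤ) - 1)
  refine ⟨range φ, fun z hz => ?_, ?_⟩
  · have key : ∀ i, ∃ v : Fin 3, addr n z i = (addr n y i + ((v : ℕ) : ℤ) - 1) % 2 ^ n := by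
      intro i
      obtain ⟨u, hu⟩ := QuotientAddGroup.mk_surjective (y i)
      change (u : UnitAddCircle) = y i at hu
      obtain ⟨w, hw, hwu⟩ := exists_coe_abs_sub_eq_dist u (z i)
      have hle : |w - u| ≤ 2⁻¹ ^ n := by
        rw [hwu, hu]
        exact (PiLp.dist_apply_le (p := 2) z y i).trans (hS z hz)
      have hp : (0 : ℝ) < 2 ^ n := by positivity
      have habs : |2 ^ n * w - 2 ^ n * u| ≤ 1 := by
        rw [← mul_sub, abs_mul, abs_of_pos hp]
        calc _ ≤ (2 : ℝ) ^ n * 2⁻¹ ^ n := by gcongr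
          _ = 1 := by rw [← mul_pow]; norm_num
      rw [abs_le] at habs
      have h1 := Int.floor_le ((2 : ℝ) ^ n * w)
      have h2 := Int.lt_floor_add_one ((2 : ℝ) ^ n * w)
      have h3 := Int.floor_le ((2 : ℝ) ^ n * u)
      have h4 := Int.lt_floor_add_one ((2 : ℝ) ^ n * u)
      have h5 : ⌊(2 : ℝ) ^ n * w⌋ < ⌊(2 : ℝ) ^ n * u⌋ + 2 := by
        have : (⌊(2 : ℝ) ^ n * w⌋ : ℝ) < ⌊(2 : ℝ) ^ n * u⌋ + 2 := by linarith
        exact_mod_cast this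
      have h6 : ⌊(2 : ℝ) ^ n * u⌋ < ⌊(2 : ℝ) ^ n * w⌋ + 2 := by
        have : (⌊(2 : ℝ) ^ n * u⌋ : ℝ) < ⌊(2 : ℝ) ^ n * w⌋ + 2 := by linarith
        exact_mod_cast this
      refine ⟨⟨(⌊(2 : ℝ) ^ n * w⌋ - ⌊(2 : ℝ) ^ n * u⌋ + 1).toNat, by omega⟩, ?_⟩
      rw [addr, addr, ← hw, ← hu, circleAddr_coe, circleAddr_coe]
      dsimp only
      rw [Int.toNat_of_nonneg (by omega), add_sub_assoc, Int.emod_add_emod]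
      congr 1
      ring
    choose v hv using key
    exact mem_biUnion (mem_range_self v) (mem_dyadicCube.2 hv)
  · rw [← iUnion_singleton_eq_range]
    refine (measure_iUnion_le _).trans ?_
    rw [tsum_fintype]
    have h : ∀ v, weight d t {φ v} = cubeDiam d n ^ t := fun v => by
      rw [weight_apply, tsum_singleton (φ v) fun c => cubeDiam d c.1 ^ t]
    simp_rw [h]
    simp

theorem tendsto_cubeDiam_rpow (d : ℕ) {t : ℝ} (ht : 0 < t) :
    Tendsto (fun n => cubeDiam d n ^ t) atTop (𝓝 0) := by
  have h1 : Tendsto (cubeDiam d) atTop (𝓝 0) := by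
    have h2 := ENNReal.Tendsto.const_mul (a := ENNReal.ofReal √d)
      (ENNReal.tendsto_pow_atTop_nhds_zero_of_lt_one (r := 2⁻¹) (by norm_num))
      (Or.inr ENNReal.ofReal_ne_top)
    rw [mul_zero] at h2
    exact h2.congr fun n => (cubeDiam_eq d n).symm
  simpa [ENNReal.zero_rpow_of_pos ht] using h1.ennrpow_const t

/-- Replaces a set of a Hausdorff cover by cubes of comparable size. The `ε` pays for sets of
diameter zero, which have no dyadic scale of their own. -/
theorem exists_cover_of_ediam_le_one {t : ℝ} (ht : 0 < t) {S : Set (Torus d)}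
    (hS : Metric.ediam S ≤ 1) {ε : ℝ≥0∞} (hε : ε ≠ 0) :
    ∃ F : Set (ℕ × (Fin d → ℤ)), S ⊆ ⋃ c ∈ F, dyadicCube c.1 c.2 ∧
      weight d t F ≤ 3 ^ d * (2 * ENNReal.ofReal √d) ^ t *
        (⨆ _ : S.Nonempty, Metric.ediam S ^ t) + ε := by
  rcases S.eq_empty_or_nonempty with rfl | hne
  · exact ⟨∅, by simp, by simp⟩
  obtain ⟨y, hy⟩ := hne
  have hsup : (⨆ _ : S.Nonempty, Metric.ediam S ^ t) = Metric.ediam S ^ t := ciSup_pos ⟨y, hy⟩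
  have htop : Metric.ediam S ≠ ∞ := (hS.trans_lt ENNReal.one_lt_top).ne
  have hdist : ∀ z ∈ S, dist z y ≤ (Metric.ediam S).toReal := fun z hz => by
    rw [dist_edist]
    exact ENNReal.toReal_mono htop (Metric.edist_le_ediam_of_mem hz hy)
  rw [hsup]
  by_cases h0 : Metric.ediam S = 0
  · have hlim : Tendsto (fun n => (3 : ℝ≥0∞) ^ d * cubeDiam d n ^ t) atTop (𝓝 0) := by
      simpa using ENNReal.Tendsto.const_mul (a := (3 : ℝ≥0∞) ^ d) (tendsto_cubeDiam_rpow d ht)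
        (Or.inr (ENNReal.pow_ne_top (by norm_num)))
    obtain ⟨n, hn⟩ := (hlim.eventually (gt_mem_nhds (pos_iff_ne_zero.2 hε))).exists
    obtain ⟨F, hF, hw⟩ := exists_cover_of_dist_le (n := n) t fun z hz =>
      (hdist z hz).trans (by rw [h0]; simp)
    exact ⟨F, hF, (hw.trans hn.le).trans le_add_self⟩
  · have hpos : 0 < (Metric.ediam S).toReal := ENNReal.toReal_pos h0 htop
    have hle1 : (Metric.ediam S).toReal ≤ 1 := by
      simpa using ENNReal.toReal_mono ENNReal.one_ne_top hS
    obtain ⟨n, hn1, hn2⟩ := exists_nat_pow_near_of_lt_one hpos hle1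
      (by norm_num : (0 : ℝ) < 2⁻¹) (by norm_num)
    obtain ⟨F, hF, hw⟩ := exists_cover_of_dist_le (n := n) t fun z hz => (hdist z hz).trans hn2
    refine ⟨F, hF, hw.trans (le_add_right ?_)⟩
    rw [mul_assoc, ← ENNReal.mul_rpow_of_nonneg _ _ ht.le]
    gcongr
    rw [cubeDiam_eq_two_mul, cubeDiam_eq, mul_assoc]
    gcongr
    rw [← ENNReal.ofReal_toReal htop]
    refine le_trans (le_of_eq ?_) (ENNReal.ofReal_le_ofReal hn1.le)
    rw [ENNReal.ofReal_pow (by norm_num), ENNReal.ofReal_inv_of_pos (by norm_num)]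
    norm_num

/-- A set of positive `t`-dimensional dyadic content has dimension at least `t`. -/
theorem le_dimH_of_dyadicContent_ne_zero {t : ℝ≥0} {E : Set (Torus d)} (ht : 0 < t)
    (hE : dyadicContent (t : ℝ) E ≠ 0) : (t : ℝ≥0∞) ≤ dimH E := by
  refine le_dimH_of_hausdorffMeasure_ne_zero fun h0 => hE ?_
  have ht' : (0 : ℝ) < t := ht
  set A : ℝ≥0∞ := 3 ^ d * (2 * ENNReal.ofReal √d) ^ (t : ℝ) with hA
  have hAt : A ≠ ∞ := ENNReal.mul_ne_top (ENNReal.pow_ne_top (by norm_num))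
    (ENNReal.rpow_ne_top_of_nonneg ht'.le (ENNReal.mul_ne_top (by norm_num) ENNReal.ofReal_ne_top))
  have key : ∀ ε : ℝ≥0∞, ε ≠ 0 → dyadicContent (t : ℝ) E ≤ A * ε + ε := by
    intro ε hε
    rw [Measure.hausdorffMeasure_apply] at h0
    -- Covers by sets of diameter at most `1` suffice: the content puts no bound on the size of its
    -- cubes.
    have h1 := (iSup₂_eq_bot.1 h0) 1 one_pos
    have h2 := h1.trans_lt (pos_iff_ne_zero.2 hε)
    simp only [iInf_lt_iff] at h2
    obtain ⟨S, hES, hS1, hSε⟩ := h2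
    obtain ⟨η, hη0, hη⟩ := ENNReal.exists_pos_sum_of_countable' hε ℕ
    choose F hF hFw using fun i => exists_cover_of_ediam_le_one ht' (hS1 i) (hη0 i).ne'
    rw [dyadicContent_eq]
    refine (iInf₂_le (⋃ i, F i) ?_).trans ?_
    · refine hES.trans (iUnion_subset fun i => (hF i).trans ?_)
      exact biUnion_subset_biUnion_left (subset_iUnion F i)
    · refine ((measure_iUnion_le _).trans (ENNReal.tsum_le_tsum hFw)).trans ?_
      rw [ENNReal.tsum_add, ENNReal.tsum_mul_left]
      gcongr
  have hlim : Tendsto (fun n : ℕ => A * (n : ℝ≥0∞)⁻¹ + (n : ℝ≥0∞)⁻¹) atTop (𝓝 0) := by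
    simpa using (ENNReal.Tendsto.const_mul ENNReal.tendsto_inv_nat_nhds_zero (Or.inr hAt)).add
      ENNReal.tendsto_inv_nat_nhds_zero
  exact le_antisymm (ge_of_tendsto' hlim fun n => key _ (by simp)) zero_le

/-- If the radii do not tend to zero, then the limsup set contains a ball. -/
theorem exists_ball_subset_limsup (x : ℕ → Torus d) {ρ : ℕ → ℝ} {ε : ℝ} (hε : 0 < ε)
    (h : ∃ᶠ j in atTop, ε ≤ ρ j) :
    ∃ a, Metric.ball a (ε / 2) ⊆ limsup (fun j => Metric.ball (x j) (ρ j)) atTop := by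
  obtain ⟨φ, hφ, hφε⟩ := extraction_of_frequently_atTop h
  -- The ball is centred at a cluster point of the centres of the large balls.
  obtain ⟨a, -, ψ, hψ, ha⟩ := isCompact_univ.tendsto_subseq (x := x ∘ φ) fun _ => mem_univ _
  refine ⟨a, fun z hz => mem_limsup_iff_frequently_mem.2 (frequently_atTop.2 fun N => ?_)⟩
  obtain ⟨i, hi, hiN⟩ := ((ha.eventually (Metric.ball_mem_nhds a (half_pos hε))).and
    (eventually_ge_atTop N)).exists
  refine ⟨φ (ψ i), hiN.trans ((hψ.id_le i).trans (hφ.id_le _)), ?_⟩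
  have h1 : dist (x (φ (ψ i))) a < ε / 2 := hi
  rw [Metric.mem_ball] at hz ⊢
  have h2 := dist_triangle_right z (x (φ (ψ i))) a
  linarith [hφε (ψ i)]

theorem ofReal_le_dimH_limsup {x : ℕ → Torus d} {r : ℕ → ℝ} (hr : ∀ j, 0 < r j)
    (hfull : lebesgue d (limsup (fun j => Metric.ball (x j) (r j)) atTop)ᶜ = 0)
    {s : ℝ} (hs : 0 < s) (hsd : s ≤ d) :
    ENNReal.ofReal s ≤
      dimH (limsup (fun j => Metric.ball (x j) (r j ^ ((d : ℝ) / s))) atTop) := by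
  have hd : (0 : ℝ) < d := hs.trans_le hsd
  have hd0 : d ≠ 0 := fun h => by simp [h] at hd
  by_cases hr0 : Tendsto r atTop (𝓝 0)
  · refine ENNReal.le_of_forall_nnreal_lt fun t ht => ?_
    rcases eq_or_ne t 0 with rfl | ht0
    · simp
    have hts : (t : ℝ) < s := by
      rwa [← ENNReal.ofReal_coe_nnreal, ENNReal.ofReal_lt_ofReal_iff hs] at ht
    -- The cube of level `0` is the whole torus.
    have h := cubeDiam_rpow_le_dyadicContent hr hfull hr0 hsd t.coe_nonneg hts 0 0
    refine (le_dimH_of_dyadicContent_ne_zero (pos_iff_ne_zero.2 ht0) fun h0 => ?_).trans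
      (dimH_mono (inter_subset_left (t := dyadicCube 0 0)))
    exact cubeDiam_rpow_ne_zero hd0 0 t (le_antisymm (h.trans h0.le) zero_le)
  · obtain ⟨ε, hε, hfreq⟩ : ∃ ε > 0, ∃ᶠ j in atTop, ε ≤ r j := by
      by_contra! hcon
      refine hr0 (Metric.tendsto_nhds.2 fun ε hε => ?_)
      filter_upwards [hcon ε hε] with j hj
      rwa [Real.dist_0_eq_abs, abs_of_pos (hr j)]
    have hε' : 0 < ε ^ ((d : ℝ) / s) := Real.rpow_pos_of_pos hε _
    obtain ⟨a, ha⟩ := exists_ball_subset_limsup x (ρ := fun j => r j ^ ((d : ℝ) / s)) hε'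
      (hfreq.mono fun j hj => Real.rpow_le_rpow hε.le hj (div_pos hd hs).le)
    refine (le_dimH_of_dyadicContent_ne_zero (Real.toNNReal_pos.2 hs) fun h0 => ?_).trans
      (dimH_mono ha)
    rw [Real.coe_toNNReal s hs.le] at h0
    have h := (lebesgue_mul_le_dyadicContent hs.le hsd (Metric.ball a _)).trans h0.le
    exact mul_ne_zero (lebesgue_ball_ne_zero a (half_pos hε')) (cubeDiam_rpow_ne_zero hd0 0 s)
      (le_antisymm h zero_le)

end Torus

theorem mainTheorem4 (d : ℕ) (x : ℕ → Torus d) (r : ℕ → ℝ) (hr : ∀ j, 0 < r j)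
    (hfull : Torus.lebesgue d (limsup (fun j => Metric.ball (x j) (r j)) atTop)ᶜ = 0)
    (s : ℝ) (hs₀ : 0 ≤ s) (hs : s ≤ d) :
    ENNReal.ofReal s ≤
        dimH (limsup (fun j => Metric.ball (x j) (Torus.shrunkRadius d s (r j))) atTop) ∧
      (Tendsto r atTop (𝓝 0) →
        limsup (fun j => Metric.ball (x j) (Torus.shrunkRadius d s (r j))) atTop ∈
          Torus.LargeIntersection d s) := by
  rcases hs₀.eq_or_lt with rfl | hpos
  -- For `s = 0` there is no `t` with `0 ≤ t < s`.
  · refine ⟨by simp, fun _ => ⟨Torus.isGδ_limsup_ball x _, fun t h0 h1 => ?_⟩⟩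
    exact absurd h1 (not_lt.2 h0)
  · simp only [Torus.shrunkRadius, if_neg hpos.ne']
    refine ⟨Torus.ofReal_le_dimH_limsup hr hfull hpos hs, fun hr0 =>
      ⟨Torus.isGδ_limsup_ball x _, fun t ht hts n k => ?_⟩⟩
    exact Torus.cubeDiam_rpow_le_dyadicContent hr hfull hr0 hs ht hts n k
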